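/- All posets are finite and nonempty, and isomorphic posets are identified. **Definitions.** A poset $P$ is an interval order if one can assign to every point $x$ a closed interval $I(x)=[\ell_x,r_x]$ of $\mathbb R$ such that $x<y$ in $P$ if and only if $r_x<\ell_y$; it is a semiorder if this is possible with all intervals of the same length. The dimension $\dim(P)$ is the least $d$ such that the order of $P$ is the intersection of $d$ linear extensions of $P$. An ascent sequence is a finite sequence $(x_1,\dots,x_n)$, $n\ge 1$, of nonnegative integers with $x_1=0$ and $0\le x_i\le 1+\#\{1\le j<i-1: x_j<x_{j+1}\}$ for $2\le i\le n$. To an ascent sequence one associates an interval order $\Psi^{-1}(x_1,\dots,x_n)$ on $n$ points, given by a multiset of $n$ integer intervals built as follows. The sequence $(0)$ gives $\{[0,0]\}$. If $(x_1,\dots,x_{n-1})$ gives the multiset $Q$, let $\ell$ be the largest right endpoint in $Q$, let $\ell^*$ be the smallest left endpoint of an interval of $Q$ with right endpoint $\ell$, and let $i=x_n$ (so that $i\le \ell+1$). - If $i\le \ell^*$, add $[i,\ell]$ to $Q$. - If $i=\ell+1$, add $[\ell+1,\ell+1]$ to $Q$. - If $\ell^*<i\le\ell$, replace every $[\lambda,\rho]$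 in $Q$ by $[\lambda+1,\rho+1]$ if $i\le\lambda$, by $[\lambda,i]$ if $\lambda<i$ and $\rho=\ell$, and by $[\lambda,\rho+1]$ if $\lambda<i\le\rho<\ell$ (intervals with $\rho<i$ are kept), and then add $[i,\ell+1]$. By a theorem of Bousquet-Mélou, Claesson, Dukes and Kitaev, $\Psi^{-1}$ is a bijection from ascent sequences of length $n$ to isomorphism classes of interval orders on $n$ points. A semiorder $P$ on $n$ points with ascent sequence $(x_1,\dots,x_n)=\Psi(P)$ is hereditary if $\Psi^{-1}(x_1,\dots,x_i)$ is a semiorder for every $1\le i\le n$. Let $\mathbf{FX}_2$ be the poset on $\{a_1,a_2,a_3,b_1,b_2,b_3,c\}$ whose cover relations are $a_1<b_1$, $a_1<b_3$, $a_1<c$, $a_2<b_1$, $a_2<b_2$, $a_2<b_3$, $a_3<b_3$, $a_3<c$, $b_2<c$. **Theorem.** Let $P$ be a semiorder. If $P$ is not hereditary, then $P$ contains $\mathbf{FX}_2$ as an (induced) subposet, and $\dim(P)=3$. -/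

import Mathlib

namespace SemiorderDim

/-! ### Semiorders and dimension -/

/-- The closed bounded real intervals `[l x, r x]` form an interval representation of `P`:
`x < y` exactly when the interval of `x` lies completely to the left of the interval of `y`. -/
def IsIntervalRepresentation (P : Type*) [PartialOrder P] (l r : P → ℝ) : Prop :=
  (∀ x, l x ≤ r x) ∧ ∀ x y, x < y ↔ r x < l y

/-- `P` is a semiorder: it has an interval representation in which all intervals have the
same length. -/
def IsSemiorder (P : Type*) [PartialOrder P] : Prop :=
  ∃ (l r : P → ℝ) (len : ℝ), IsIntervalRepresentation P l r ∧ ∀ x, r x - l x = len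

/-- The total order `L` on the points of `P` is a linear extension of `P`. -/
def IsLinearExtension (P : Type*) [PartialOrder P] (L : LinearOrder P) : Prop :=
  ∀ x y : P, x ≤ y → L.le x y

/-- There are `d` linear extensions of `P` whose intersection is the order of `P`. -/
def HasRealizer (P : Type*) [PartialOrder P] (d : ℕ) : Prop :=
  ∃ L : Fin d → LinearOrder P,
    (∀ i, IsLinearExtension P (L i)) ∧ ∀ x y : P, x ≤ y ↔ ∀ i, (L i).le x y

/-- `dim P = d`: `d` is the least number of linear extensions of `P` that intersect to the
order of `P`. -/
def HasDimension (P : Type*) [PartialOrder P] (d : ℕ) : Prop :=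
  IsLeast {k : ℕ | HasRealizer P k} d

/-! ### The poset `FX₂` -/

/-- The seven points of the poset `FX₂`. -/
inductive FX₂
  | a₁ | a₂ | a₃ | b₁ | b₂ | b₃ | c

/-- The strict order of `FX₂`. Its cover relations are `a₁ < b₁, b₃, c`; `a₂ < b₁, b₂, b₃`;
`a₃ < b₃, c`; `b₂ < c`, and the only further relation is `a₂ < c`. -/
def FX₂.rel : FX₂ → FX₂ → Prop
  | .a₁, .b₁ | .a₁, .b₃ | .a₁, .c => True
  | .a₂, .b₁ | .a₂, .b₂ | .a₂, .b₃ | .a₂, .c => True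
  | .a₃, .b₃ | .a₃, .c => True
  | .b₂, .c => True
  | _, _ => False

instance : PartialOrder FX₂ where
  le x y := x = y ∨ FX₂.rel x y
  lt x y := FX₂.rel x y
  le_refl x := Or.inl rfl
  le_trans x y z := by cases x <;> cases y <;> cases z <;> simp [FX₂.rel]
  lt_iff_le_not_ge x y := by cases x <;> cases y <;> simp [FX₂.rel]
  le_antisymm x y := by cases x <;> cases y <;> simp [FX₂.rel]

/-! ### Interval orders given by lists of integer intervals -/

/-- A closed interval `[left, right]` with endpoints in `ℕ`. -/
@[ext] structure NatInterval where
  left : ℕ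
  right : ℕ
  left_le_right : left ≤ right

/-- The points of the interval order represented by the list `Q`: one point for each entry of
the list, so that repeated intervals give distinct points. -/
structure IntervalOrder (Q : List NatInterval) where
  idx : Fin Q.length

/-- The interval of a point. -/
def IntervalOrder.interval {Q : List NatInterval} (x : IntervalOrder Q) : NatInterval :=
  Q.get x.idx

instance (Q : List NatInterval) : PartialOrder (IntervalOrder Q) where
  le x y := x = y ∨ x.interval.right < y.interval.left
  lt x y := x.interval.right < y.interval.left
  le_refl x := Or.inl rfl
  le_trans x y z := by
    rintro (rfl | hxy) (rfl | hyz)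
    · exact Or.inl rfl
    · exact Or.inr hyz
    · exact Or.inr hxy
    · exact Or.inr (by have := y.interval.left_le_right; omega)
  lt_iff_le_not_ge x y := by
    have hx := x.interval.left_le_right
    have hy := y.interval.left_le_right
    constructor
    · intro h
      refine ⟨Or.inr h, ?_⟩
      rintro (rfl | h') <;> omega
    · rintro ⟨rfl | h, h'⟩
      · exact absurd (Or.inl rfl) h'
      · exact h
  le_antisymm x y := by
    have hx := x.interval.left_le_right
    have hy := y.interval.left_le_right
    rintro (h | h) (h' | h')
    · exact h
    · exact h
    · exact h'.symm
    · omega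

/-! ### Ascent sequences and the map from ascent sequences to interval orders -/

/-- The number of ascents `x_j < x_{j+1}` of a sequence. -/
def asc (x : List ℕ) : ℕ :=
  ((Finset.range (x.length - 1)).filter fun j => x.getD j 0 < x.getD (j + 1) 0).card

/-- `(x_1, …, x_n)`, `n ≥ 1`, is an ascent sequence: `x_1 = 0` and
`0 ≤ x_i ≤ 1 + asc (x_1, …, x_{i-1})` for `2 ≤ i ≤ n`. (The list is indexed from `0`.) -/
def IsAscentSequence (x : List ℕ) : Prop :=
  x.head? = some 0 ∧
    ∀ k : ℕ, 1 ≤ k → k < x.length → x.getD k 0 ≤ 1 + asc (x.take k)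

/-- `ℓ(Q)`: the largest right endpoint of an interval of `Q`. -/
def maxRight (Q : List NatInterval) : ℕ :=
  Q.foldr (fun J m => max J.right m) 0

/-- `ℓ*(Q)`: the smallest left endpoint of an interval of `Q` with right endpoint `ℓ(Q)`. -/
def minLeft (Q : List NatInterval) : ℕ :=
  Q.foldr (fun J m => if J.right = maxRight Q then min J.left m else m) (maxRight Q)

/-- The effect of Move 3, with new endpoint `i` and largest right endpoint `ℓ`, on an interval
that is already present: shift it, truncate it, stretch it, or leave it unchanged. -/
def moveThree (i ℓ : ℕ) (J : NatInterval) : NatInterval :=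
  if i ≤ J.left then ⟨J.left + 1, J.right + 1, Nat.add_le_add_right J.left_le_right 1⟩
  else if h : J.left < i ∧ J.right = ℓ then ⟨J.left, i, h.1.le⟩
  else if i ≤ J.right then ⟨J.left, J.right + 1, Nat.le_succ_of_le J.left_le_right⟩
  else J

theorem minLeft_le_maxRight (Q : List NatInterval) : minLeft Q ≤ maxRight Q := by
  unfold minLeft
  generalize maxRight Q = ℓ
  induction Q with
  | nil => exact le_rfl
  | cons J Q ih =>
    simp only [List.foldr_cons]
    split
    · exact (min_le_right _ _).trans ih
    · exact ih

/-- Add one point to the minimal endpoint representation `Q`, according to the next term `i` of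
the ascent sequence. The first point gets the interval `[0, 0]`; afterwards Move 1 is used if
`i ≤ ℓ*(Q)`, Move 3 if `ℓ*(Q) < i ≤ ℓ(Q)`, and Move 2 if `i = ℓ(Q) + 1`, the only other
possibility along an ascent sequence. -/
def addPoint (Q : List NatInterval) (i : ℕ) : List NatInterval :=
  if Q = [] then [⟨0, 0, le_rfl⟩]
  else if h : i ≤ minLeft Q then
    ⟨i, maxRight Q, h.trans (minLeft_le_maxRight Q)⟩ :: Q
  else if h : i ≤ maxRight Q then
    ⟨i, maxRight Q + 1, Nat.le_succ_of_le h⟩ :: Q.map (moveThree i (maxRight Q))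
  else ⟨maxRight Q + 1, maxRight Q + 1, le_rfl⟩ :: Q

/-- The minimal endpoint representation that an ascent sequence is sent to. -/
def representation (x : List ℕ) : List NatInterval :=
  x.foldl addPoint []

/-- The interval order `Ψ⁻¹(x)` that corresponds to the ascent sequence `x` under the bijection
`Ψ` of Bousquet-Mélou, Claesson, Dukes and Kitaev between (isomorphism classes of) interval
orders on `n ≥ 1` points and ascent sequences of length `n`. -/
abbrev PsiInv (x : List ℕ) : Type :=
  IntervalOrder (representation x)

/-- `P` is a hereditary semiorder: it corresponds to an ascent sequence `x` such that every
nonempty initial subsequence of `x` (`x` itself included, so that `P` is a semiorder)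
corresponds to a semiorder. Since `Ψ` is a bijection, `x` is the ascent sequence of `P`. -/
def IsHereditary (P : Type*) [PartialOrder P] : Prop :=
  ∃ x : List ℕ, IsAscentSequence x ∧ Nonempty (P ≃o PsiInv x) ∧
    ∀ k : ℕ, 1 ≤ k → k ≤ x.length → IsSemiorder (PsiInv (x.take k))

end SemiorderDim

namespace SemiorderDim

/-! The proof goes by contraposition: a semiorder without `FX₂` is hereditary. A semiorder `P` has a
minimal endpoint representation `Q` (`IsSemiorder.exists_isMinimal`), and minimality turns the
absence of 3 + 1 into properness of `Q` (`IsMinimal.isProper`). Removing the interval with the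
largest right endpoint and, among those, the smallest left endpoint undoes one step of the
construction (`IsMinimal.exists_addPoint`). Undoing Moves 1 and 2 only deletes a point. Undoing Move
3 also lengthens the intervals ending at the new endpoint, so a longer interval may come to contain
another in its interior; in that case the neighbouring endpoints supplied by minimality exhibit
`FX₂` (`IsMoveThree.isProper_undo_or`). Conversely, a copy of `FX₂` after the undoing can be
repaired to one before it (`IsMoveThree.containsFX₂_of_undo`). So "proper without `FX₂`" descends to
every stage, and the removed left endpoints spell an ascent sequence all of whose prefixes give
semiorders. Heredity asks only for some such sequence, so injectivity of the correspondence is not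
needed.

For the dimension, three explicit linear extensions built from a unit representation realize any
finite semiorder (`IsSemiorder.hasRealizer_three`). Two do not suffice for `FX₂`: in a realizer of
size two, the order of one incomparable pair forces that of others, and a chain of forcings leads
from a pair to its own reversal (`not_hasRealizer_two_FX₂`). -/

/-! ### Unit interval representations -/

/-- Let `R j k` be a relation on `ℕ` that persists when `j` decreases and `k` increases. For
`j < k` in an initial segment of `ℕ` it is the relation `f j + 1 < f k` of a strictly increasing
real sequence. -/
theorem exists_unit_sequence (R : ℕ → ℕ → Prop)
    (hmono : ∀ j j' k k', j' ≤ j → k ≤ k' → R j k → R j' k') (n : ℕ) :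
    ∃ f : ℕ → ℝ, ∀ j k, j < k → k < n →
      f j < f k ∧ (R j k → f j + 1 < f k) ∧ (¬ R j k → f k < f j + 1) := by
  classical
  induction n with
  | zero => exact ⟨fun _ => 0, fun j k _ hk => absurd hk (Nat.not_lt_zero k)⟩
  | succ n ih =>
    obtain ⟨f, hf⟩ := ih
    -- The next value must exceed all earlier values and every `f a + 1` with `R a n`, and stay
    -- below every `f b + 1` with `¬ R b n`. Monotonicity of `R` makes the bounds compatible: `R a
    -- n` and `¬ R b n` force `a < b`, and `¬ R b n` implies `¬ R b a` for `a < n`.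
    obtain ⟨v, hlo, hhi⟩ := Order.exists_between_finsets
      (lo := (Finset.range n).image f ∪ ((Finset.range n).filter fun j => R j n).image (f · + 1))
      (hi := ((Finset.range n).filter fun j => ¬ R j n).image (f · + 1)) (by
        intro x hx y hy
        simp only [Finset.mem_union, Finset.mem_image, Finset.mem_filter, Finset.mem_range] at hx hy
        obtain ⟨b, ⟨hbn, hb⟩, rfl⟩ := hy
        rcases hx with ⟨a, ha, rfl⟩ | ⟨a, ⟨han, ha⟩, rfl⟩
        · rcases lt_trichotomy b a with h | rfl | h
          · exact (hf b a h ha).2.2 fun h' => hb (hmono _ _ _ _ le_rfl ha.le h')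
          · linarith
          · linarith [(hf a b h hbn).1]
        · have hab : a < b := by
            by_contra h
            exact hb (hmono _ _ _ _ (not_lt.1 h) le_rfl ha)
          linarith [(hf a b hab hbn).1])
    simp only [Finset.mem_union, Finset.mem_image, Finset.mem_filter, Finset.mem_range] at hlo hhi
    refine ⟨Function.update f n v, fun j k hjk hk => ?_⟩
    rw [Function.update_of_ne (by omega : j ≠ n)]
    rcases Nat.lt_succ_iff_lt_or_eq.1 hk with hk | rfl
    · rw [Function.update_of_ne hk.ne]
      exact hf j k hjk hk
    · rw [Function.update_self]
      exact ⟨hlo _ (Or.inl ⟨j, hjk, rfl⟩), fun h => hlo _ (Or.inr ⟨j, ⟨hjk, h⟩, rfl⟩),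
        fun h => hhi _ ⟨j, ⟨hjk, h⟩, rfl⟩⟩

/-- A finite poset whose strict order is compatible with a ranking of its points has a unit
interval representation that refines the ranking and has no touching intervals. -/
theorem exists_unit_representation {P : Type*} [PartialOrder P] [Finite P] (κ : P → ℕ)
    (hlt : ∀ x y, x < y → κ x < κ y)
    (hmono : ∀ x x' y y', κ x' ≤ κ x → κ y ≤ κ y' → x < y → x' < y') :
    ∃ f : P → ℝ, (∀ x y, κ x < κ y → f x < f y) ∧ (∀ x y, x < y ↔ f x + 1 < f y) ∧
      ∀ x y, f x + 1 ≠ f y := by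
  obtain ⟨N, hN⟩ := (Set.finite_range κ).bddAbove
  -- The relation on ranks is the monotone closure of the order; by `hmono` it adds no relation
  -- between actual points.
  obtain ⟨f, hf⟩ := exists_unit_sequence (fun j k => ∃ x y, j ≤ κ x ∧ κ y ≤ k ∧ x < y)
    (fun j j' k k' hj hk ⟨x, y, hx, hy, h⟩ => ⟨x, y, hj.trans hx, hy.trans hk, h⟩) (N + 1)
  have hf' : ∀ x y, κ x < κ y → f (κ x) < f (κ y) ∧ (x < y → f (κ x) + 1 < f (κ y)) ∧
      (¬ x < y → f (κ y) < f (κ x) + 1) := by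
    intro x y h
    obtain ⟨h1, h2, h3⟩ := hf _ _ h (Nat.lt_succ_of_le (hN ⟨y, rfl⟩))
    exact ⟨h1, fun hxy => h2 ⟨x, y, le_rfl, le_rfl, hxy⟩,
      fun hxy => h3 fun ⟨x', y', hx, hy, h'⟩ => hxy (hmono _ _ _ _ hx hy h')⟩
  have key : ∀ x y, (x < y → f (κ x) + 1 < f (κ y)) ∧ (¬ x < y → f (κ y) < f (κ x) + 1) := by
    intro x y
    rcases lt_trichotomy (κ x) (κ y) with h | h | h
    · exact (hf' x y h).2
    · refine ⟨fun hxy => absurd (hlt x y hxy) h.not_lt, fun _ => ?_⟩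
      rw [h]; linarith
    · refine ⟨fun hxy => absurd (hlt x y hxy) h.not_gt, fun _ => ?_⟩
      linarith [(hf' y x h).1]
  refine ⟨fun x => f (κ x), fun x y h => (hf' x y h).1, fun x y => ⟨(key x y).1, fun h => ?_⟩,
    fun x y h => ?_⟩
  · by_contra hxy
    linarith [(key x y).2 hxy]
  · by_cases hxy : x < y
    · linarith [(key x y).1 hxy]
    · linarith [(key x y).2 hxy]

/-- A poset whose order is given by a real function through `x < y ↔ f x + 1 < f y` is a
semiorder. -/
theorem isSemiorder_of_unit {P : Type*} [PartialOrder P] (f : P → ℝ)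
    (hf : ∀ x y, x < y ↔ f x + 1 < f y) : IsSemiorder P :=
  ⟨f, fun x => f x + 1, 1, ⟨fun x => by simp, hf⟩, fun x => by simp⟩

/-- A finite semiorder has an injective unit interval representation without touching
intervals. -/
theorem IsSemiorder.exists_injective_unit {P : Type*} [PartialOrder P] [Finite P]
    (hP : IsSemiorder P) :
    ∃ f : P → ℝ, Function.Injective f ∧ (∀ x y, x < y ↔ f x + 1 < f y) ∧
      ∀ x y, f x + 1 ≠ f y := by
  obtain ⟨l, r, len, ⟨hlr, hlt⟩, hlen⟩ := hP
  obtain ⟨n, ⟨e⟩⟩ := Finite.exists_equiv_fin P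
  -- Points are ranked by left endpoint. The enumeration breaks ties, which is what makes `f`
  -- injective.
  let key : P → ℝ ×ₗ Fin n := fun x => toLex (l x, e x)
  have hkey : Function.Injective key := fun x y h => by
    simp only [key, EmbeddingLike.apply_eq_iff_eq, Prod.mk.injEq] at h
    exact h.2
  let S : Set (ℝ ×ₗ Fin n) := Set.range key
  have : Fintype S := (Set.finite_range key).fintype
  let o := Fintype.orderIsoFinOfCardEq S rfl
  let κ : P → ℕ := fun x => (o.symm ⟨key x, x, rfl⟩ : Fin _)
  have hκ : ∀ x y, κ x < κ y ↔ key x < key y := by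
    intro x y
    simp only [κ, Fin.val_fin_lt, OrderIso.lt_iff_lt]
    exact Iff.rfl
  have hκl : ∀ x y, κ x ≤ κ y → l x ≤ l y := by
    intro x y h
    rw [← not_lt, hκ, not_lt, Prod.Lex.le_iff] at h
    rcases h with h | h
    · exact h.le
    · exact h.1.le
  have hle : ∀ x, r x = l x + len := fun x => by linarith [hlen x]
  obtain ⟨f, hf1, hf2, hf3⟩ := exists_unit_representation κ
    (fun x y h => by
      rw [hκ, Prod.Lex.lt_iff]
      exact Or.inl (lt_of_le_of_lt (hlr x) ((hlt x y).1 h)))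
    (fun x x' y y' hx hy h => by
      rw [hlt, hle] at h ⊢
      linarith [hκl _ _ hx, hκl _ _ hy])
  refine ⟨f, fun x y h => ?_, hf2, hf3⟩
  by_contra hxy
  rcases lt_or_gt_of_ne (fun h' => hxy (hkey h') : key x ≠ key y) with h' | h'
  · exact (hf1 x y ((hκ x y).2 h')).ne h
  · exact (hf1 y x ((hκ y x).2 h')).ne h.symm

/-! ### Semiorders have dimension at most three -/

/-- The linear order that compares the values of an injective key. -/
theorem exists_linearOrder_of_key {P K : Type*} [LinearOrder K] (key : P → K)
    (h : Function.Injective key) :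
    ∃ L : LinearOrder P, ∀ x y, L.le x y ↔ key x ≤ key y :=
  ⟨LinearOrder.lift' key h, fun _ _ => Iff.rfl⟩

/-- The key whose order reverses the incomparable pairs with one value of `f` in
`[2k, 2k + 1)` and the other in `[2k + 1, 2k + 2)`. -/
noncomputable def pairKey (t : ℝ) : ℤ ×ₗ ℝ :=
  toLex (⌊t / 2⌋, if t < 2 * ⌊t / 2⌋ + 1 then t + 1 else t)

/-- Inside a block `[2k, 2k + 2)` the lower half is raised by 1. Even when only `s` is raised, `s +
1` is still below `t`. -/
theorem pairKey_lt {s t : ℝ} (h : s + 1 < t) : pairKey s < pairKey t := by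
  have h1 := Int.floor_le (s / 2)
  have h2 := Int.lt_floor_add_one (s / 2)
  have h3 := Int.floor_le (t / 2)
  have h4 := Int.lt_floor_add_one (t / 2)
  rw [Prod.Lex.lt_iff]
  simp only [pairKey, ofLex_toLex]
  rcases lt_or_ge ⌊s / 2⌋ ⌊t / 2⌋ with h5 | h5
  · exact Or.inl h5
  · have h6 : ⌊s / 2⌋ = ⌊t / 2⌋ :=
      le_antisymm (Int.floor_le_floor (by linarith)) h5
    refine Or.inr ⟨h6, ?_⟩
    rw [h6] at h1 h2 ⊢
    split_ifs <;> linarith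

/-- Raising one half of a block by 1 can only identify values at distance exactly 1, that is,
touching intervals. -/
theorem pairKey_injOn {s t : ℝ} (h : s + 1 ≠ t) (h' : t + 1 ≠ s) (hst : pairKey s = pairKey t) :
    s = t := by
  simp only [pairKey, EmbeddingLike.apply_eq_iff_eq, Prod.mk.injEq] at hst
  obtain ⟨h1, h2⟩ := hst
  split_ifs at h2
  · linarith
  · exact absurd h2 h
  · exact absurd h2.symm h'
  · exact h2

/-- The two floors are consecutive. If the lower one is even, both values share a block and raising
`s` takes it past `t`; if it is odd, translation by 1 makes it even. -/
theorem pairKey_reverse {s t : ℝ} (h : ⌊s⌋ < ⌊t⌋) (h' : t < s + 1) :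
    pairKey t < pairKey s ∨ pairKey (t + 1) < pairKey (s + 1) := by
  have hs1 := Int.floor_le s
  have hs2 := Int.lt_floor_add_one s
  have ht1 := Int.floor_le t
  have ht2 := Int.lt_floor_add_one t
  have hst : ⌊t⌋ = ⌊s⌋ + 1 := by
    have : (⌊t⌋ : ℝ) < ⌊s⌋ + 2 := by linarith
    have : ⌊t⌋ < ⌊s⌋ + 2 := by exact_mod_cast this
    omega
  rw [hst] at ht1 ht2
  push_cast at ht1 ht2
  simp only [Prod.Lex.lt_iff, pairKey, ofLex_toLex]
  rcases Int.even_or_odd' ⌊s⌋ with ⟨k, hk | hk⟩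
  · left; right
    rw [hk] at hs1 hs2 ht1 ht2
    push_cast at hs1 hs2 ht1 ht2
    have e1 : ⌊s / 2⌋ = k := Int.floor_eq_iff.2 ⟨by linarith, by linarith⟩
    have e2 : ⌊t / 2⌋ = k := Int.floor_eq_iff.2 ⟨by linarith, by linarith⟩
    rw [e1, e2]
    refine ⟨rfl, ?_⟩
    rw [if_neg (by linarith), if_pos (by linarith)]
    exact h'
  · right; right
    rw [hk] at hs1 hs2 ht1 ht2
    push_cast at hs1 hs2 ht1 ht2
    have e1 : ⌊(s + 1) / 2⌋ = k + 1 :=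
      Int.floor_eq_iff.2 ⟨by push_cast; linarith, by push_cast; linarith⟩
    have e2 : ⌊(t + 1) / 2⌋ = k + 1 :=
      Int.floor_eq_iff.2 ⟨by push_cast; linarith, by push_cast; linarith⟩
    rw [e1, e2]
    refine ⟨rfl, ?_⟩
    push_cast
    rw [if_neg (by linarith), if_pos (by linarith)]
    linarith

/-- Rabinovitch: a finite semiorder is the intersection of three linear extensions. -/
theorem IsSemiorder.hasRealizer_three {P : Type*} [PartialOrder P] [Finite P]
    (hP : IsSemiorder P) : HasRealizer P 3 := by
  obtain ⟨f, hinj, hlt, hne⟩ := hP.exists_injective_unit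
  have hne' : ∀ x y, f x + 1 + 1 ≠ f y + 1 := fun x y h => hne x y (by linarith)
  -- `L₀` reverses `f` inside each unit cell and keeps the cells in order. `L₁` and `L₂` reverse
  -- close pairs across the cell boundaries at odd and at even integers, respectively.
  obtain ⟨L₀, h₀⟩ := exists_linearOrder_of_key (fun x => (toLex (⌊f x⌋, -f x) : ℤ ×ₗ ℝ))
    (fun x y h => by
      simp only [EmbeddingLike.apply_eq_iff_eq, Prod.mk.injEq, neg_inj] at h
      exact hinj h.2)
  obtain ⟨L₁, h₁⟩ := exists_linearOrder_of_key (fun x => pairKey (f x))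
    (fun x y h => hinj (pairKey_injOn (hne _ _) (hne _ _) h))
  obtain ⟨L₂, h₂⟩ := exists_linearOrder_of_key (fun x => pairKey (f x + 1))
    (fun x y h => hinj (add_right_cancel (pairKey_injOn (hne' _ _) (hne' _ _) h)))
  have ext₀ : ∀ x y, x < y → L₀.le x y := by
    intro x y h
    rw [hlt] at h
    rw [h₀, Prod.Lex.le_iff]
    refine Or.inl (Int.lt_of_lt_of_le (Int.lt_add_one_of_le le_rfl) ?_)
    change ⌊f x⌋ + 1 ≤ ⌊f y⌋
    rw [← Int.floor_add_one]
    exact Int.floor_le_floor h.le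
  have ext₁ : ∀ x y, x < y → L₁.le x y := fun x y h =>
    (h₁ x y).2 (pairKey_lt ((hlt x y).1 h)).le
  have ext₂ : ∀ x y, x < y → L₂.le x y := fun x y h =>
    (h₂ x y).2 (pairKey_lt (by linarith [(hlt x y).1 h])).le
  have of_all : ∀ x y, L₀.le x y → L₁.le x y → L₂.le x y → x ≤ y := by
    intro x y k₀ k₁ k₂
    by_contra hxy
    have hxy1 : ¬ f x + 1 < f y := fun h => hxy ((hlt x y).2 h).le
    rw [h₀, Prod.Lex.le_iff] at k₀
    rw [h₁] at k₁
    rw [h₂] at k₂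
    simp only [ofLex_toLex] at k₀
    rcases k₀ with k | ⟨k, k'⟩
    · rcases pairKey_reverse k (lt_of_le_of_ne (not_lt.1 hxy1) (hne x y).symm) with h | h
      · exact absurd k₁ (not_le.2 h)
      · exact absurd k₂ (not_le.2 h)
    · have hyx : f y < f x := by
        refine lt_of_le_of_ne (by linarith) fun h => hxy ?_
        rw [hinj h]
      have hfl : ⌊f y / 2⌋ = ⌊f x / 2⌋ := by
        have e1 := Int.floor_div_natCast (f y) 2
        have e2 := Int.floor_div_natCast (f x) 2
        push_cast at e1 e2
        rw [e1, e2, k]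
      refine absurd k₁ (not_le.2 ?_)
      simp only [pairKey, Prod.Lex.lt_iff, ofLex_toLex]
      refine Or.inr ⟨hfl, ?_⟩
      rw [hfl]
      have a1 := Int.floor_le (f x)
      have a2 := Int.lt_floor_add_one (f x)
      have a3 := Int.floor_le (f y)
      have a4 := Int.lt_floor_add_one (f y)
      -- Which half of its block a value lies in depends only on its floor, so `x` and `y` are both
      -- raised or both kept and `L₁` orders them as `f` does.
      have iff1 : ∀ z : P, ⌊f z⌋ = ⌊f x⌋ →
          (f z < 2 * (⌊f x / 2⌋ : ℝ) + 1 ↔ ⌊f x⌋ < 2 * ⌊f x / 2⌋ + 1) := by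
        intro z hz
        rw [← hz, Int.floor_lt]
        push_cast
        exact Iff.rfl
      have e1 := iff1 x rfl
      have e2 := iff1 y k.symm
      by_cases hc : ⌊f x⌋ < 2 * ⌊f x / 2⌋ + 1
      · rw [if_pos (e1.2 hc), if_pos (e2.2 hc)]
        linarith
      · rw [if_neg (fun h => hc (e1.1 h)), if_neg (fun h => hc (e2.1 h))]
        exact hyx
  have hext : ∀ i : Fin 3, IsLinearExtension P (![L₀, L₁, L₂] i) := by
    intro i x y h
    rcases h.eq_or_lt with rfl | h
    · exact (![L₀, L₁, L₂] i).le_refl x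
    · fin_cases i
      · exact ext₀ x y h
      · exact ext₁ x y h
      · exact ext₂ x y h
  exact ⟨![L₀, L₁, L₂], hext, fun x y => ⟨fun h i => hext i x y h,
    fun h => of_all x y (h 0) (h 1) (h 2)⟩⟩

/-! ### `FX₂` has dimension greater than two -/

theorem HasRealizer.of_orderEmbedding {P Q : Type*} [PartialOrder P] [PartialOrder Q] {d : ℕ}
    (e : P ↪o Q) (h : HasRealizer Q d) : HasRealizer P d := by
  obtain ⟨L, h1, h2⟩ := h
  choose M hM using fun i =>
    @exists_linearOrder_of_key P Q (L i) e e.injective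
  refine ⟨M, fun i x y hxy => (hM i x y).2 (h1 i _ _ (e.le_iff_le.2 hxy)), fun x y => ?_⟩
  rw [← e.le_iff_le, h2]
  exact forall_congr' fun i => (hM i x y).symm

/-- A realizer may be enlarged by repeating linear extensions. -/
theorem HasRealizer.two_of_le {P : Type*} [PartialOrder P] {d : ℕ} (hd : d ≤ 2)
    (h : HasRealizer P d) (hP : ∃ x y : P, ¬ x ≤ y) : HasRealizer P 2 := by
  obtain ⟨L, h1, h2⟩ := h
  interval_cases d
  · obtain ⟨x, y, hxy⟩ := hP
    exact absurd ((h2 x y).2 fun i => i.elim0) hxy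
  · refine ⟨fun _ => L 0, fun _ => h1 0, fun x y => ?_⟩
    rw [h2]
    exact ⟨fun h _ => h 0, fun h i => by rw [Subsingleton.elim i 0]; exact h 0⟩
  · exact ⟨L, h1, h2⟩

/-- This is the forcing relation for transitive orientations of the incomparability graph. The two
extensions order an incomparable pair oppositely, so if `v` lay between `u` and `w` in one of them,
the other would put `w` before `u`. -/
theorem le_congr_of_realizer_two {P : Type*} [PartialOrder P] {L : Fin 2 → LinearOrder P}
    (h1 : ∀ i, IsLinearExtension P (L i)) (h2 : ∀ x y : P, x ≤ y ↔ ∀ i, (L i).le x y)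
    {u v w : P} (huv : ¬ u ≤ v) (hwv : ¬ w ≤ v) (hvw : ¬ v ≤ w)
    (huw : u ≤ w) :
    ((L 0).le u v ↔ (L 0).le w v) ∧ ((L 0).le v u ↔ (L 0).le v w) := by
  have flip : ∀ x y : P, ¬ x ≤ y → (L 0).le x y → (L 1).le y x := by
    intro x y hxy h
    refine ((L 1).le_total x y).resolve_left fun h' => hxy ((h2 x y).2 fun i => ?_)
    fin_cases i
    · exact h
    · exact h'
  have up : (L 0).le w v → (L 0).le u v := fun h => (L 0).le_trans _ _ _ (h1 0 _ _ huw) h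
  have up' : (L 0).le v u → (L 0).le v w := fun h => (L 0).le_trans _ _ _ h (h1 0 _ _ huw)
  have down : (L 0).le u v → ¬ (L 0).le v w := by
    intro h h'
    have e : u = w := (L 1).le_antisymm _ _ (h1 1 _ _ huw)
      ((L 1).le_trans _ _ _ (flip _ _ hvw h') (flip _ _ huv h))
    subst e
    exact huv ((L 0).le_antisymm _ _ h h' ▸ le_rfl)
  refine ⟨⟨fun h => ((L 0).le_total w v).resolve_right (down h), up⟩,
    ⟨up', fun h => ((L 0).le_total u v).resolve_left fun h' => down h' h⟩⟩

theorem not_hasRealizer_two_FX₂ : ¬ HasRealizer FX₂ 2 := by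
  rintro ⟨L, h1, h2⟩
  have le_iff : ∀ x y : FX₂, x ≤ y ↔ x = y ∨ FX₂.rel x y := fun _ _ => Iff.rfl
  have step : ∀ u v w : FX₂, ¬ u ≤ v ∧ ¬ w ≤ v ∧ ¬ v ≤ w ∧ u ≤ w →
      ((L 0).le u v ↔ (L 0).le w v) ∧ ((L 0).le v u ↔ (L 0).le v w) :=
    fun u v w ⟨a, b, c, d⟩ => le_congr_of_realizer_two h1 h2 a b c d
  -- The pairs forced in turn, each read as "first before second", are `a₁a₂`, `a₁b₂`, `b₁b₂`,
  -- `b₁c`, `b₁a₃`, `a₂a₃`, `b₂a₃`, `b₂b₃`, `b₂a₁`, `a₂a₁`.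
  have s1 := (step .a₂ .a₁ .b₂ (by simp [le_iff, FX₂.rel])).2
  have s2 := (step .a₁ .b₂ .b₁ (by simp [le_iff, FX₂.rel])).1
  have s3 := (step .b₂ .b₁ .c (by simp [le_iff, FX₂.rel])).2
  have s4 := (step .a₃ .b₁ .c (by simp [le_iff, FX₂.rel])).2
  have s5 := (step .a₂ .a₃ .b₁ (by simp [le_iff, FX₂.rel])).1
  have s6 := (step .a₂ .a₃ .b₂ (by simp [le_iff, FX₂.rel])).1
  have s7 := (step .a₃ .b₂ .b₃ (by simp [le_iff, FX₂.rel])).2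
  have s8 := (step .a₁ .b₂ .b₃ (by simp [le_iff, FX₂.rel])).2
  have s9 := (step .a₂ .a₁ .b₂ (by simp [le_iff, FX₂.rel])).1
  have hiff : (L 0).le .a₁ .a₂ ↔ (L 0).le .a₂ .a₁ := by
    rw [s1, s2, s3, ← s4, ← s5, s6, s7, ← s8, ← s9]
  have hboth : (L 0).le .a₁ .a₂ ∧ (L 0).le .a₂ .a₁ := by
    rcases (L 0).le_total .a₁ .a₂ with h | h
    · exact ⟨h, hiff.1 h⟩
    · exact ⟨hiff.2 h, h⟩
  exact FX₂.noConfusion ((L 0).le_antisymm _ _ hboth.1 hboth.2)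

/-- A finite semiorder that contains `FX₂` has dimension three. -/
theorem IsSemiorder.hasDimension_three {P : Type*} [PartialOrder P] [Finite P]
    (hP : IsSemiorder P) (e : FX₂ ↪o P) : HasDimension P 3 := by
  refine ⟨hP.hasRealizer_three, fun d hd => ?_⟩
  by_contra hlt
  have hd' : HasRealizer P d := hd
  refine not_hasRealizer_two_FX₂
    ((hd'.of_orderEmbedding e).two_of_le (by omega) ⟨.b₁, .a₁, ?_⟩)
  rintro (h | h)
  · exact FX₂.noConfusion h
  · exact h


/-! ### Interval lists -/

theorem le_maxRight {Q : List NatInterval} {J : NatInterval} (hJ : J ∈ Q) :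
    J.right ≤ maxRight Q := by
  induction Q with
  | nil => simp at hJ
  | cons K Q ih =>
    simp only [maxRight, List.foldr_cons]
    rcases List.mem_cons.1 hJ with rfl | h
    · exact le_max_left _ _
    · exact (ih h).trans (le_max_right _ _)

theorem exists_right_eq_maxRight {Q : List NatInterval} (hQ : Q ≠ []) :
    ∃ J ∈ Q, J.right = maxRight Q := by
  induction Q with
  | nil => exact absurd rfl hQ
  | cons K Q ih =>
    have e : maxRight (K :: Q) = max K.right (maxRight Q) := rfl
    by_cases hQ' : Q = []
    · subst hQ'
      exact ⟨K, by simp, by simp [maxRight]⟩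
    · obtain ⟨J, hJ, h⟩ := ih hQ'
      rcases le_total K.right (maxRight Q) with h' | h'
      · exact ⟨J, List.mem_cons_of_mem _ hJ, by rw [e, max_eq_right h', h]⟩
      · exact ⟨K, List.mem_cons_self, by rw [e, max_eq_left h']⟩

theorem maxRight_eq {Q : List NatInterval} {m : ℕ} (hle : ∀ J ∈ Q, J.right ≤ m)
    (hex : ∃ J ∈ Q, J.right = m) : maxRight Q = m := by
  obtain ⟨J, hJ, rfl⟩ := hex
  obtain ⟨K, hK, h⟩ := exists_right_eq_maxRight (List.ne_nil_of_mem hJ)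
  exact le_antisymm (h ▸ hle K hK) (le_maxRight hJ)

/-- The bound by `maxRight Q` reflects the starting value of the fold; it adds nothing when `Q` is
nonempty. -/
theorem le_minLeft_iff {Q : List NatInterval} {i : ℕ} :
    i ≤ minLeft Q ↔ i ≤ maxRight Q ∧ ∀ J ∈ Q, J.right = maxRight Q → i ≤ J.left := by
  unfold minLeft
  generalize maxRight Q = m
  induction Q with
  | nil => simp
  | cons K Q ih =>
    simp only [List.foldr_cons, List.mem_cons, forall_eq_or_imp]
    split_ifs with h
    · rw [le_min_iff, ih]
      tauto
    · rw [ih]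
      tauto

theorem maxRight_perm {Q Q' : List NatInterval} (h : Q.Perm Q') : maxRight Q = maxRight Q' := by
  by_cases hQ : Q = []
  · subst hQ
    rw [h.nil_eq]
  · obtain ⟨J, hJ, hJm⟩ := exists_right_eq_maxRight hQ
    exact (maxRight_eq (fun K hK => le_maxRight (h.mem_iff.2 hK))
      ⟨J, h.mem_iff.1 hJ, hJm⟩).symm

theorem minLeft_perm {Q Q' : List NatInterval} (h : Q.Perm Q') : minLeft Q = minLeft Q' := by
  refine eq_of_forall_le_iff fun i => ?_
  rw [le_minLeft_iff, le_minLeft_iff, maxRight_perm h]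
  simp only [h.mem_iff]

/-- Lists stand for multisets here: removing a point and adding it again recovers a list only up to
order. -/
theorem addPoint_perm {Q Q' : List NatInterval} (h : Q.Perm Q') (i : ℕ) :
    (addPoint Q i).Perm (addPoint Q' i) := by
  have h1 := maxRight_perm h
  have h2 := minLeft_perm h
  by_cases hQ : Q = []
  · subst hQ
    rw [h.nil_eq]
  · have hQ' : Q' ≠ [] := fun e => hQ (by subst e; exact h.eq_nil)
    unfold addPoint
    rw [if_neg hQ, if_neg hQ']
    simp only [h1, h2]
    split_ifs
    · exact h.cons _
    · exact (h.map _).cons _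
    · exact h.cons _

/-- Permuting a list of intervals does not change the interval order. -/
theorem IntervalOrder.orderIso_of_perm {Q Q' : List NatInterval} (h : Q.Perm Q') :
    Nonempty (IntervalOrder Q ≃o IntervalOrder Q') := by
  classical
  let e : IntervalOrder Q → IntervalOrder Q' := fun x => ⟨h.idxBij x.idx⟩
  have he : Function.Bijective e := by
    constructor
    · rintro ⟨a⟩ ⟨b⟩ hab
      exact congrArg _ (List.Perm.idxBij_injective h (IntervalOrder.mk.inj hab))
    · rintro ⟨b⟩
      obtain ⟨a, ha⟩ := List.Perm.idxBij_surjective h b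
      exact ⟨⟨a⟩, congrArg _ ha⟩
  have hi : ∀ x, (e x).interval = x.interval := fun x =>
    List.Perm.getElem_idxBij_eq_getElem h x.idx
  refine ⟨⟨Equiv.ofBijective e he, fun {x y} => ?_⟩⟩
  change (e x = e y ∨ (e x).interval.right < (e y).interval.left) ↔
    (x = y ∨ x.interval.right < y.interval.left)
  rw [hi, hi, he.1.eq_iff]

/-! ### Minimal and proper interval lists. -/

/-- Every number up to the largest right endpoint is a left endpoint and a right endpoint, as in
the minimal endpoint representation of an interval order. -/
def IsMinimal (Q : List NatInterval) : Prop :=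
  Q ≠ [] ∧ ∀ k ≤ maxRight Q, (∃ J ∈ Q, J.left = k) ∧ ∃ J ∈ Q, J.right = k

/-- No interval contains another one in its interior. -/
def IsProper (Q : List NatInterval) : Prop :=
  ∀ J ∈ Q, ∀ K ∈ Q, J.left < K.left → J.right ≤ K.right

/-- Some intervals of the list represent `FX₂`. -/
def ContainsFX₂ (Q : List NatInterval) : Prop :=
  ∃ g : FX₂ → NatInterval, (∀ v, g v ∈ Q) ∧ ∀ u v, FX₂.rel u v ↔ (g u).right < (g v).left

theorem IsProper.perm {Q Q' : List NatInterval} (h : Q.Perm Q') (hQ : IsProper Q) :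
    IsProper Q' := by
  unfold IsProper at hQ ⊢
  simpa only [h.mem_iff] using hQ

theorem ContainsFX₂.mono {Q Q' : List NatInterval} (h : Q ⊆ Q') (hQ : ContainsFX₂ Q) :
    ContainsFX₂ Q' := by
  obtain ⟨g, hg, hrel⟩ := hQ
  exact ⟨g, fun v => h (hg v), hrel⟩

instance (Q : List NatInterval) : Finite (IntervalOrder Q) :=
  Finite.of_injective (fun x => x.idx) (fun x y h => by cases x; cases y; exact congrArg _ h)

theorem IntervalOrder.interval_mem {Q : List NatInterval} (x : IntervalOrder Q) :
    x.interval ∈ Q := List.get_mem _ _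

theorem IntervalOrder.exists_interval_eq {Q : List NatInterval} {J : NatInterval} (hJ : J ∈ Q) :
    ∃ x : IntervalOrder Q, x.interval = J := by
  obtain ⟨n, hn⟩ := List.get_of_mem hJ
  exact ⟨⟨n⟩, hn⟩

/-- In a proper list, the sum of the endpoints ranks the intervals consistently with both endpoints
at once, so it can serve as the rank of a unit representation. -/
theorem IsProper.isSemiorder {Q : List NatInterval} (hQ : IsProper Q) :
    IsSemiorder (IntervalOrder Q) := by
  have hlt : ∀ x y : IntervalOrder Q, x < y ↔ x.interval.right < y.interval.left :=
    fun _ _ => Iff.rfl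
  have hp : ∀ x y : IntervalOrder Q, x.interval.left + x.interval.right ≤
      y.interval.left + y.interval.right →
      x.interval.left ≤ y.interval.left ∧ x.interval.right ≤ y.interval.right := by
    intro x y h
    have h1 := hQ _ x.interval_mem _ y.interval_mem
    have h2 := hQ _ y.interval_mem _ x.interval_mem
    omega
  obtain ⟨f, -, hf, -⟩ := exists_unit_representation
    (fun x : IntervalOrder Q => x.interval.left + x.interval.right)
    (fun x y h => by
      rw [hlt] at h
      have h1 := x.interval.left_le_right
      have h2 := y.interval.left_le_right
      omega)
    (fun x x' y y' hx hy h => by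
      rw [hlt] at h ⊢
      have h1 := hp _ _ hx
      have h2 := hp _ _ hy
      omega)
  exact isSemiorder_of_unit f hf

/-- A semiorder contains no `3 + 1`. -/
theorem IsSemiorder.not_three_add_one {P : Type*} [PartialOrder P] (hP : IsSemiorder P)
    {u v w y : P} (huv : u < v) (hvw : v < w) : u < y ∨ y < w := by
  obtain ⟨l, r, len, ⟨hlr, hlt⟩, hlen⟩ := hP
  rw [hlt] at *
  rw [hlt]
  by_contra! h
  linarith [hlen v, hlen y, h.1, h.2]

/-- If `K` lies in the interior of `J`, minimality provides an interval ending where `J` starts and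
one starting where `J` ends. With `K` they form a chain of three points, all incomparable to `J`. -/
theorem IsMinimal.isProper {Q : List NatInterval} (hQ : IsMinimal Q)
    (hs : IsSemiorder (IntervalOrder Q)) : IsProper Q := by
  intro J hJ K hK hl
  by_contra! hr
  obtain ⟨-, A, hA, hAr⟩ := hQ.2 J.left (J.left_le_right.trans (le_maxRight hJ))
  obtain ⟨⟨B, hB, hBl⟩, -⟩ := hQ.2 J.right (le_maxRight hJ)
  obtain ⟨u, rfl⟩ := IntervalOrder.exists_interval_eq hA
  obtain ⟨v, rfl⟩ := IntervalOrder.exists_interval_eq hK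
  obtain ⟨w, rfl⟩ := IntervalOrder.exists_interval_eq hB
  obtain ⟨y, rfl⟩ := IntervalOrder.exists_interval_eq hJ
  have huv : u < v := show u.interval.right < v.interval.left by omega
  have hvw : v < w := show v.interval.right < w.interval.left by omega
  rcases hs.not_three_add_one (y := y) huv hvw with h | h
  · have : u.interval.right < y.interval.left := h
    omega
  · have : y.interval.right < w.interval.left := h
    omega

/-- No two points of `FX₂` have the same strict upper and lower bounds. -/
theorem FX₂.eq_of_twin {u v : FX₂} (h : ∀ w, (FX₂.rel u w ↔ FX₂.rel v w) ∧
    (FX₂.rel w u ↔ FX₂.rel w v)) : u = v := by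
  have h1 := h .b₁
  have h2 := h .b₂
  have h3 := h .b₃
  have h4 := h .a₁
  have h5 := h .a₃
  have h6 := h .a₂
  cases u <;> cases v <;> simp [FX₂.rel] at *

/-- Injectivity is not part of `ContainsFX₂`; it is automatic because `FX₂` has no twins. -/
theorem ContainsFX₂.exists_orderEmbedding {Q : List NatInterval} (h : ContainsFX₂ Q) :
    Nonempty (FX₂ ↪o IntervalOrder Q) := by
  obtain ⟨g, hg, hrel⟩ := h
  choose e he using fun v => IntervalOrder.exists_interval_eq (hg v)
  refine ⟨OrderEmbedding.ofMapLEIff e fun u v => ?_⟩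
  change (e u = e v ∨ (e u).interval.right < (e v).interval.left) ↔ (u = v ∨ FX₂.rel u v)
  rw [he, he, hrel]
  refine or_congr_left ⟨fun h => FX₂.eq_of_twin fun w => ?_, fun h => h ▸ rfl⟩
  have : g u = g v := by rw [← he, h, he]
  simp only [hrel, this, and_self]

/-! ### The minimal endpoint representation of a finite interval order -/

/-- Natural-number intervals that represent the order of `P`. -/
def Represents {P : Type*} [PartialOrder P] (I : P → NatInterval) : Prop :=
  ∀ x y, x < y ↔ (I x).right < (I y).left

theorem IsSemiorder.exists_represents {P : Type*} [PartialOrder P] [Finite P]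
    (hP : IsSemiorder P) : ∃ I : P → NatInterval, Represents I := by
  classical
  obtain ⟨l, r, len, ⟨hlr, hlt⟩, -⟩ := hP
  have := Fintype.ofFinite P
  let S : Finset ℝ := Finset.univ.image l ∪ Finset.univ.image r
  -- Each real is replaced by the number of endpoints strictly below it, which is strictly
  -- increasing on endpoints.
  let c : ℝ → ℕ := fun v => (S.filter (· < v)).card
  have hmono : Monotone c := fun v w h => Finset.card_le_card fun t ht => by
    simp only [Finset.mem_filter] at ht ⊢
    exact ⟨ht.1, ht.2.trans_le h⟩
  have hstrict : ∀ v w, v ∈ S → v < w → c v < c w := fun v w hv h =>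
    Finset.card_lt_card ((Finset.ssubset_iff_of_subset fun t ht => by
      simp only [Finset.mem_filter] at ht ⊢
      exact ⟨ht.1, ht.2.trans h⟩).2 ⟨v, by simp [hv, h], by simp⟩)
  refine ⟨fun x => ⟨c (l x), c (r x), hmono (hlr x)⟩, fun x y => ?_⟩
  rw [hlt]
  refine ⟨fun h => hstrict _ _ (by simp [S]) h, fun h => ?_⟩
  by_contra h'
  exact absurd h (not_lt.2 (hmono (not_lt.1 h')))

/-- Mapping all endpoints by a monotone function. -/
def NatInterval.map (g : ℕ → ℕ) (hg : Monotone g) (J : NatInterval) : NatInterval :=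
  ⟨g J.left, g J.right, hg J.left_le_right⟩

/-- A finite nonempty poset that is represented by natural-number intervals has a representation
in which every number up to the largest right endpoint is a left and a right endpoint. -/
theorem Represents.exists_minimal {P : Type*} [PartialOrder P] [Finite P] [Nonempty P]
    {I₀ : P → NatInterval} (h₀ : Represents I₀) :
    ∃ I : P → NatInterval, Represents I ∧
      ∀ z k, k ≤ (I z).right → (∃ x, (I x).left = k) ∧ ∃ x, (I x).right = k := by
  classical
  have := Fintype.ofFinite P
  let size : (P → NatInterval) → ℕ := fun I => ∑ x, (I x).right
  -- A representation with least total of right endpoints admits no order-preserving compression.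
  obtain ⟨I, hI, hmin⟩ := exists_minimalFor_of_wellFoundedLT Represents size ⟨I₀, h₀⟩
  have hno : ∀ (g : ℕ → ℕ) (hg : Monotone g), (∀ k, g k ≤ k) →
      (∀ x y, (I x).right < (I y).left ↔ g (I x).right < g (I y).left) →
      ∀ z, g (I z).right = (I z).right := by
    intro g hg hle hiff z
    by_contra hne
    have hsum : size (fun x => (I x).map g hg) < size I :=
      Finset.sum_lt_sum (fun x _ => hle _) ⟨z, Finset.mem_univ z, lt_of_le_of_ne (hle _) hne⟩
    exact absurd (hmin (j := fun x => (I x).map g hg) (fun x y => (hI x y).trans (hiff x y))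
      hsum.le) (not_le.2 hsum)
  refine ⟨I, hI, fun z k hk => ⟨?_, ?_⟩⟩
  · by_contra! h
    -- Merging `k - 1` with `k` could only lose a relation between a right endpoint `k - 1` and a
    -- left endpoint `k`, and the latter is missing.
    have := hno (fun v => if k ≤ v then v - 1 else v)
      (fun v w hvw => by dsimp only; split_ifs <;> omega)
      (fun v => by split_ifs <;> omega)
      (fun x y => by
        have := h y
        have := h x
        have := (I x).left_le_right
        split_ifs <;> omega) z
    have h1 := h z
    have h2 := (I z).left_le_right
    split_ifs at this
    omega
  · by_contra! h
    -- Here `k` and `k + 1` merge, which is harmless because no right endpoint equals `k`.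
    have := hno (fun v => if k < v then v - 1 else v)
      (fun v w hvw => by dsimp only; split_ifs <;> omega)
      (fun v => by split_ifs <;> omega)
      (fun x y => by
        have := h x
        split_ifs <;> omega) z
    have h1 := h z
    split_ifs at this <;> omega

/-- Every finite nonempty semiorder is the interval order of a minimal interval list. -/
theorem IsSemiorder.exists_isMinimal {P : Type*} [PartialOrder P] [Finite P] [Nonempty P]
    (hP : IsSemiorder P) :
    ∃ Q, IsMinimal Q ∧ Nonempty (P ≃o IntervalOrder Q) := by
  obtain ⟨I₀, h₀⟩ := hP.exists_represents
  obtain ⟨I, hI, hmin⟩ := h₀.exists_minimal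
  obtain ⟨n, ⟨e⟩⟩ := Finite.exists_equiv_fin P
  have hmem : ∀ J, J ∈ List.ofFn (fun i => I (e.symm i)) ↔ ∃ x, I x = J := fun J => by
    rw [List.mem_ofFn]
    exact ⟨fun ⟨i, hi⟩ => ⟨_, hi⟩, fun ⟨x, hx⟩ => ⟨e x, by simpa using hx⟩⟩
  have hne : List.ofFn (fun i => I (e.symm i)) ≠ [] :=
    List.ne_nil_of_mem ((hmem _).2 ⟨Classical.arbitrary P, rfl⟩)
  refine ⟨List.ofFn fun i => I (e.symm i), ⟨hne, fun k hk => ?_⟩, ?_⟩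
  · obtain ⟨J, hJ, hJm⟩ := exists_right_eq_maxRight hne
    obtain ⟨z, rfl⟩ := (hmem J).1 hJ
    obtain ⟨⟨x, hx⟩, ⟨y, hy⟩⟩ := hmin z k (hJm ▸ hk)
    exact ⟨⟨_, (hmem _).2 ⟨x, rfl⟩, hx⟩, ⟨_, (hmem _).2 ⟨y, rfl⟩, hy⟩⟩
  · let φ : P ≃ IntervalOrder (List.ofFn fun i => I (e.symm i)) :=
      (e.trans (finCongr List.length_ofFn.symm)).trans
        ⟨fun a => ⟨a⟩, fun x => x.idx, fun _ => rfl, fun _ => rfl⟩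
    have hφ : ∀ x, (φ x).interval = I x := fun x => by
      simp [φ, IntervalOrder.interval]
    refine ⟨⟨φ, fun {x y} => ?_⟩⟩
    change (φ x = φ y ∨ (φ x).interval.right < (φ y).interval.left) ↔ x ≤ y
    rw [hφ, hφ, ← hI, φ.apply_eq_iff_eq, le_iff_eq_or_lt]


/-- Inequalities between the endpoints of seven intervals under which they represent `FX₂`. -/
theorem containsFX₂_of_le {Q : List NatInterval} {a₁ a₂ a₃ b₁ b₂ b₃ c : NatInterval}
    (ha₁ : a₁ ∈ Q) (ha₂ : a₂ ∈ Q) (ha₃ : a₃ ∈ Q) (hb₁ : b₁ ∈ Q) (hb₂ : b₂ ∈ Q) (hb₃ : b₃ ∈ Q)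
    (hc : c ∈ Q) (h1 : a₁.left ≤ a₂.right) (h2 : a₃.left ≤ a₂.right) (h3 : a₂.right < b₂.left)
    (h4 : b₂.left ≤ a₁.right) (h5 : a₁.right < b₁.left) (h6 : b₁.left ≤ a₃.right)
    (h7 : a₃.right < b₃.left) (h8 : b₃.left ≤ b₂.right) (h9 : b₂.right < c.left)
    (h10 : c.left ≤ b₁.right) (h11 : c.left ≤ b₃.right) : ContainsFX₂ Q := by
  have h12 := a₂.left_le_right
  have h13 := c.left_le_right
  refine ⟨fun v => match v with
    | .a₁ => a₁ | .a₂ => a₂ | .a₃ => a₃ | .b₁ => b₁ | .b₂ => b₂ | .b₃ => b₃ | .c => c, ?_, ?_⟩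
  · intro v
    cases v <;> assumption
  · intro u v
    cases u <;> cases v <;> simp only [FX₂.rel, true_iff, false_iff] <;> omega

/-! ### Undoing the addition of a point -/

/-- Undo Move 3 with new endpoint `i` and old largest right endpoint `m`. -/
def undoMoveThree (i m : ℕ) (J : NatInterval) : NatInterval :=
  if hl : i < J.left then ⟨J.left - 1, J.right - 1, Nat.sub_le_sub_right J.left_le_right 1⟩
  else if h : J.right = i ∧ i ≤ m then ⟨J.left, m, J.left_le_right.trans (h.1.trans_le h.2)⟩
  else if h : i < J.right then ⟨J.left, J.right - 1, by omega⟩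
  else J

/-- The last term of the ascent sequence `i` was used to insert the interval `x = [i, m + 1]` by
Move 3. -/
structure IsMoveThree (Q₀ : List NatInterval) (i m : ℕ) (x : NatInterval) : Prop where
  left_eq : x.left = i
  right_eq : x.right = m + 1
  pos : 0 < i
  le_old : i ≤ m
  left_ne : ∀ J ∈ Q₀, J.left ≠ i
  right_le : ∀ J ∈ Q₀, J.right ≤ m + 1
  lt_left : ∀ J ∈ Q₀, J.right = m + 1 → i < J.left
  exists_right : ∃ J ∈ Q₀, J.right = m + 1
  minimal : ∀ k ≤ m + 1, (∃ J ∈ x :: Q₀, J.left = k) ∧ ∃ J ∈ x :: Q₀, J.right = k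

namespace IsMoveThree

variable {Q₀ : List NatInterval} {i m : ℕ} {x : NatInterval}

theorem exists_left (h : IsMoveThree Q₀ i m x) {k : ℕ} (hk : k ≤ m + 1) (hki : k ≠ i) :
    ∃ J ∈ Q₀, J.left = k := by
  obtain ⟨J, hJ, e⟩ := (h.minimal k hk).1
  rcases List.mem_cons.1 hJ with rfl | hJ
  · exact absurd (e.symm.trans h.left_eq) hki
  · exact ⟨J, hJ, e⟩

theorem exists_right_of_le (h : IsMoveThree Q₀ i m x) {k : ℕ} (hk : k ≤ m + 1) :
    ∃ J ∈ Q₀, J.right = k := by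
  rcases hk.eq_or_lt with rfl | hk'
  · exact h.exists_right
  · obtain ⟨J, hJ, e⟩ := (h.minimal k hk).2
    rcases List.mem_cons.1 hJ with rfl | hJ
    · have := h.right_eq
      omega
    · exact ⟨J, hJ, e⟩

theorem undo_left (i m : ℕ) (J : NatInterval) :
    (undoMoveThree i m J).left = if i < J.left then J.left - 1 else J.left := by
  unfold undoMoveThree
  split_ifs <;> rfl

theorem undo_right (h : IsMoveThree Q₀ i m x) {J : NatInterval} (hJ : J ∈ Q₀) :
    (undoMoveThree i m J).right =
      if J.right < i then J.right else if J.right = i then m else J.right - 1 := by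
  have h1 := h.left_ne J hJ
  have h2 := h.le_old
  have h3 := J.left_le_right
  unfold undoMoveThree
  split_ifs <;> first | rfl | omega

theorem move_undo (h : IsMoveThree Q₀ i m x) {J : NatInterval} (hJ : J ∈ Q₀) :
    moveThree i m (undoMoveThree i m J) = J := by
  have h1 := h.left_ne J hJ
  have h2 := h.le_old
  have h3 := J.left_le_right
  have h4 := h.right_le J hJ
  have h5 := h.lt_left J hJ
  have h6 := undo_left i m J
  have h7 := h.undo_right hJ
  generalize undoMoveThree i m J = K at h6 h7
  have h8 := K.left_le_right
  have h9 := h.pos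
  ext <;> simp only [moveThree, h6, h7] <;> split_ifs <;> simp_all <;> omega

/-- Undoing Move 3 stretches the intervals ending at `i` back to the end `m`, so they become
maximal. All other comparisons survive, since no left endpoint equals `i`. -/
theorem undo_lt_iff (h : IsMoveThree Q₀ i m x) {J K : NatInterval} (hJ : J ∈ Q₀) (hK : K ∈ Q₀) :
    (undoMoveThree i m J).right < (undoMoveThree i m K).left ↔
      J.right ≠ i ∧ J.right < K.left := by
  rw [undo_left, h.undo_right hJ]
  have h1 := h.left_ne K hK
  have h2 := h.le_old
  have h3 := K.left_le_right
  have h4 := h.right_le K hK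
  split_ifs <;> omega

theorem maxRight_undo (h : IsMoveThree Q₀ i m x) :
    maxRight (Q₀.map (undoMoveThree i m)) = m := by
  refine maxRight_eq (fun J' hJ' => ?_) ?_
  · obtain ⟨J, hJ, rfl⟩ := List.mem_map.1 hJ'
    rw [h.undo_right hJ]
    have h1 := h.le_old
    have h2 := h.right_le J hJ
    split_ifs <;> omega
  · obtain ⟨J, hJ, e⟩ := h.exists_right
    refine ⟨_, List.mem_map_of_mem hJ, ?_⟩
    rw [h.undo_right hJ]
    have h1 := h.le_old
    split_ifs <;> omega

theorem isMinimal_undo (h : IsMoveThree Q₀ i m x) :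
    IsMinimal (Q₀.map (undoMoveThree i m)) := by
  refine ⟨?_, fun k hk => ?_⟩
  · obtain ⟨J, hJ, -⟩ := h.exists_right
    exact List.ne_nil_of_mem (List.mem_map_of_mem hJ)
  · rw [h.maxRight_undo] at hk
    have h1 := h.le_old
    constructor
    · obtain ⟨J, hJ, e⟩ := h.exists_left (k := if k < i then k else k + 1)
        (by split_ifs <;> omega) (by split_ifs <;> omega)
      refine ⟨_, List.mem_map_of_mem hJ, ?_⟩
      rw [undo_left, e]
      split_ifs <;> omega
    · obtain ⟨J, hJ, e⟩ := h.exists_right_of_le (k := if k < i then k else k + 1)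
        (by split_ifs <;> omega)
      refine ⟨_, List.mem_map_of_mem hJ, ?_⟩
      rw [h.undo_right hJ, e]
      split_ifs <;> omega

/-- An interval of `Q₀` ending at `i` starts before `i` and is stretched to the end `m`. Hence
`addPoint` does take the branch of Move 3. -/
theorem minLeft_undo_lt (h : IsMoveThree Q₀ i m x) :
    minLeft (Q₀.map (undoMoveThree i m)) < i := by
  obtain ⟨J, hJ, e⟩ := h.exists_right_of_le (h.le_old.trans (Nat.le_succ m))
  by_contra! hle
  have := (le_minLeft_iff.1 hle).2 _ (List.mem_map_of_mem hJ)
    (by rw [h.undo_right hJ, h.maxRight_undo, e]; simp)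
  rw [undo_left] at this
  have h1 := J.left_le_right
  have h2 := h.left_ne J hJ
  split_ifs at this <;> omega

theorem addPoint_undo (h : IsMoveThree Q₀ i m x) :
    addPoint (Q₀.map (undoMoveThree i m)) i = x :: Q₀ := by
  have h1 : (Q₀.map (undoMoveThree i m)).map (moveThree i m) = Q₀ := by
    rw [List.map_map]
    exact (List.map_congr_left fun J hJ => h.move_undo hJ).trans (List.map_id _)
  unfold addPoint
  rw [if_neg h.isMinimal_undo.1, dif_neg (not_le.2 h.minLeft_undo_lt),
    dif_pos (by rw [h.maxRight_undo]; exact h.le_old)]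
  simp only [h.maxRight_undo, h1]
  congr 1
  ext
  · exact h.left_eq.symm
  · exact h.right_eq.symm

/-- If undoing Move 3 destroys properness, then the interval list contains `FX₂`. -/
theorem isProper_undo_or (h : IsMoveThree Q₀ i m x) (hp : IsProper (x :: Q₀)) :
    IsProper (Q₀.map (undoMoveThree i m)) ∨ ContainsFX₂ (x :: Q₀) := by
  by_contra! hcon
  obtain ⟨hprop, hfx⟩ := hcon
  refine hprop fun J' hJ' K' hK' hl => ?_
  obtain ⟨J, hJ, rfl⟩ := List.mem_map.1 hJ'
  obtain ⟨K, hK, rfl⟩ := List.mem_map.1 hK'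
  by_contra! hr
  rw [undo_left, undo_left] at hl
  rw [h.undo_right hJ, h.undo_right hK] at hr
  have hJQ := List.mem_cons_of_mem x hJ
  have hKQ := List.mem_cons_of_mem x hK
  have hxQ : x ∈ x :: Q₀ := List.mem_cons_self
  have hJi := h.left_ne J hJ
  have hKi := h.left_ne K hK
  have him := h.le_old
  have hJm := h.right_le J hJ
  have hKm := h.right_le K hK
  have hxl := h.left_eq
  have hxr := h.right_eq
  have hpJK := hp J hJQ K hKQ
  have hpxK := hp x hxQ K hKQ
  have hpos := h.pos
  have hJlr := J.left_le_right
  have hKlr := K.left_le_right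
  -- Properness can fail only when `J` is stretched, i.e. ends at `i`, while `K` starts between
  -- `J.left` and `i` and ends strictly between `i` and `m + 1`. Properness against `x` excludes
  -- `K.left > i`.
  have hl' : J.left < K.left := by split_ifs at hl <;> omega
  have hJr : J.right = i := by split_ifs at hr <;> omega
  have hKr : i < K.right ∧ K.right ≤ m := by split_ifs at hr <;> omega
  have hKl : K.left < i := by omega
  -- Minimality supplies the rest of `FX₂`: `a₁ = B`, `a₂ = A`, `a₃ = J`, `b₁ = x`, `b₂ = K`, `b₃ =
  -- D`, `c = C`. Properness gives `B.left ≤ J.left` and makes `C` and `D` reach `m + 1`.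
  obtain ⟨A, hA, hAr⟩ := h.exists_right_of_le (k := J.left) (by omega)
  obtain ⟨B, hB, hBr⟩ := h.exists_right_of_le (k := i - 1) (by omega)
  obtain ⟨C, hC, hCl⟩ := h.exists_left (k := K.right + 1) (by omega) (by omega)
  obtain ⟨D, hD, hDl⟩ := h.exists_left (k := i + 1) (by omega) (by omega)
  have hAlr := A.left_le_right
  have hBlr := B.left_le_right
  have hpJB := hp J hJQ B (List.mem_cons_of_mem x hB)
  have hpxC := hp x hxQ C (List.mem_cons_of_mem x hC)
  have hpxD := hp x hxQ D (List.mem_cons_of_mem x hD)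
  have mem : ∀ {I}, I ∈ Q₀ → I ∈ x :: Q₀ := List.mem_cons_of_mem x
  exact hfx (containsFX₂_of_le (mem hB) (mem hA) hJQ hxQ hKQ (mem hD) (mem hC)
    (by omega) (by omega) (by omega) (by omega) (by omega) (by omega) (by omega) (by omega)
    (by omega) (by omega) (by omega))

/-- Undoing Move 3 does not create `FX₂`. -/
theorem containsFX₂_of_undo (h : IsMoveThree Q₀ i m x) (hp : IsProper (x :: Q₀))
    (hfx : ContainsFX₂ (Q₀.map (undoMoveThree i m))) : ContainsFX₂ (x :: Q₀) := by
  obtain ⟨g', hg', hrel'⟩ := hfx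
  choose g hg hgg' using fun v => List.mem_map.1 (hg' v)
  have hrel : ∀ u v, FX₂.rel u v ↔ (g u).right ≠ i ∧ (g u).right < (g v).left := fun u v => by
    rw [hrel', ← hgg', ← hgg', h.undo_lt_iff (hg u) (hg v)]
  have hgQ : ∀ v, g v ∈ x :: Q₀ := fun v => List.mem_cons_of_mem x (hg v)
  -- If no chosen interval ends at `i` while another starts beyond `i`, the same intervals already
  -- represent `FX₂` before the undoing. Otherwise `c` is replaced by `x`.
  by_cases hall : ∀ u v, (g u).right = i → (g v).left ≤ i
  · refine ⟨g, hgQ, fun u v => ?_⟩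
    rw [hrel]
    have := hall u v
    omega
  push Not at hall
  obtain ⟨u, v, hu, hv⟩ := hall
  have hxQ : x ∈ x :: Q₀ := List.mem_cons_self
  have lt : ∀ u v, FX₂.rel u v → (g u).right < (g v).left := fun u v huv =>
    ((hrel u v).1 huv).2
  have le : ∀ u v, (g u).right ≠ i → ¬ FX₂.rel u v → (g v).left ≤ (g u).right :=
    fun u v hui huv => not_lt.1 fun h' => huv ((hrel u v).2 ⟨hui, h'⟩)
  have n1 : (g .a₁).right ≠ i := ((hrel .a₁ .c).1 trivial).1
  have n2 : (g .a₂).right ≠ i := ((hrel .a₂ .c).1 trivial).1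
  have n3 : (g .a₃).right ≠ i := ((hrel .a₃ .c).1 trivial).1
  have n4 : (g .b₂).right ≠ i := ((hrel .b₂ .c).1 trivial).1
  have r1 := lt .a₂ .b₂ trivial
  have r2 := le .a₁ .b₂ n1 not_false
  have r3 := lt .a₁ .b₁ trivial
  have r4 := le .a₃ .b₁ n3 not_false
  have r5 := lt .a₃ .b₃ trivial
  have r6 := le .b₂ .b₃ n4 not_false
  have r7 := lt .b₂ .c trivial
  have r8 := le .a₂ .a₁ n2 not_false
  have r9 := le .a₂ .a₃ n2 not_false
  -- `c` has the largest left endpoint of the copy, so it starts beyond `i` as soon as some member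
  -- does.
  have hc : i < (g .c).left := by
    have := (g .a₂).left_le_right
    cases v <;> omega
  have notmax : ∀ u, (g u).right = i → u = .b₁ ∨ u = .b₃ := fun u hu => by
    have := (g .c).left_le_right
    cases u
    case b₁ => exact Or.inl rfl
    case b₃ => exact Or.inr rfl
    all_goals omega
  -- The interval ending at `i` is `b₁` or `b₃`, both of which start after `b₂` starts. By
  -- properness `b₂` ends no later than `i`, and it does not end at `i`, so it lies left of `x`.
  have hb : (g .b₂).right < i := by
    by_contra! hb
    rcases notmax u hu with rfl | rfl
    · have := hp _ (hgQ .b₂) _ (hgQ .b₁)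
      omega
    · have := hp _ (hgQ .b₂) _ (hgQ .b₃)
      omega
  have top : ∀ u, ¬ FX₂.rel u .c → i ≤ (g u).right := fun u hu' => by
    by_contra! h'
    have := le u .c h'.ne hu'
    omega
  have hxl := h.left_eq
  exact containsFX₂_of_le (hgQ .a₁) (hgQ .a₂) (hgQ .a₃) (hgQ .b₁) (hgQ .b₂) (hgQ .b₃) hxQ
    r8 r9 r1 r2 r3 r4 r5 r6 (by omega) (hxl.trans_le (top .b₁ not_false))
    (hxl.trans_le (top .b₃ not_false))

end IsMoveThree

/-! ### Peeling off the last point. -/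

theorem exists_minLeft {Q : List NatInterval} (hQ : Q ≠ []) :
    ∃ J ∈ Q, J.right = maxRight Q ∧ J.left = minLeft Q := by
  by_contra! h
  have hle := (le_minLeft_iff (Q := Q)).1 le_rfl
  obtain ⟨J, hJ, hJm⟩ := exists_right_eq_maxRight hQ
  have h1 : ∀ K ∈ Q, K.right = maxRight Q → minLeft Q + 1 ≤ K.left := fun K hK hKm =>
    lt_of_le_of_ne (hle.2 K hK hKm) (h K hK hKm).symm
  have h2 := le_minLeft_iff.2 ⟨(h1 J hJ hJm).trans (J.left_le_right.trans hJm.le), h1⟩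
  omega

/-- Every minimal interval list with at least two entries arises from a smaller one by adding a
point; properness and the absence of `FX₂` are inherited by the smaller list. -/
theorem IsMinimal.exists_addPoint {Q : List NatInterval} (hQ : IsMinimal Q)
    (hlen : 2 ≤ Q.length) :
    ∃ Q' i, IsMinimal Q' ∧ Q'.length + 1 = Q.length ∧ (addPoint Q' i).Perm Q ∧
      i ≤ maxRight Q' + 1 ∧ minLeft Q = i ∧
      maxRight Q = maxRight Q' + (if minLeft Q' < i then 1 else 0) ∧
      (IsProper Q → ¬ ContainsFX₂ Q → IsProper Q' ∧ ¬ ContainsFX₂ Q') := by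
  classical
  obtain ⟨x, hx, hxr, hxl⟩ := exists_minLeft hQ.1
  have hperm : Q.Perm (x :: Q.erase x) := List.perm_cons_erase hx
  generalize Q.erase x = Q₀ at hperm
  have hlen₀ := hperm.length_eq
  rw [List.length_cons] at hlen₀
  have hne : Q₀ ≠ [] := by
    rintro rfl
    simp only [List.length_nil] at hlen₀
    omega
  have hmem : ∀ J, J ∈ Q ↔ J = x ∨ J ∈ Q₀ := fun J => by
    rw [hperm.mem_iff, List.mem_cons]
  have hle : ∀ J ∈ Q₀, J.right ≤ maxRight Q := fun J hJ => le_maxRight ((hmem J).2 (Or.inr hJ))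
  have hleft : ∀ J ∈ Q₀, J.right = maxRight Q → minLeft Q ≤ J.left := fun J hJ h =>
    (le_minLeft_iff.1 le_rfl).2 J ((hmem J).2 (Or.inr hJ)) h
  have hmin : ∀ k ≤ maxRight Q, (∃ J, (J = x ∨ J ∈ Q₀) ∧ J.left = k) ∧
      ∃ J, (J = x ∨ J ∈ Q₀) ∧ J.right = k := by
    simpa only [hmem] using hQ.2
  have hxlr := x.left_le_right
  have hsub : IsProper Q → ¬ ContainsFX₂ Q → IsProper Q₀ ∧ ¬ ContainsFX₂ Q₀ := fun hp hfx =>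
    ⟨fun J hJ K hK => hp J ((hmem J).2 (Or.inr hJ)) K ((hmem K).2 (Or.inr hK)),
      fun h => hfx (h.mono fun J hJ => (hmem J).2 (Or.inr hJ))⟩
  -- The move being undone is read off from what `x` alone contributes: neither endpoint value for
  -- Move 1, only the left one for Move 3, the largest right endpoint for Move 2.
  by_cases hr : ∃ J ∈ Q₀, J.right = maxRight Q
  · by_cases hl : ∃ J ∈ Q₀, J.left = minLeft Q
    · have hmax : maxRight Q₀ = maxRight Q := maxRight_eq hle hr
      have hml : minLeft Q ≤ minLeft Q₀ := by
        rw [le_minLeft_iff, hmax]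
        exact ⟨minLeft_le_maxRight Q, hleft⟩
      refine ⟨Q₀, minLeft Q, ⟨hne, fun k hk => ?_⟩, hlen₀.symm, ?_, ?_, rfl, ?_, hsub⟩
      · rw [hmax] at hk
        obtain ⟨⟨J, hJ, hJk⟩, ⟨K, hK, hKk⟩⟩ := hmin k hk
        constructor
        · rcases hJ with rfl | hJ
          · rwa [← hJk, hxl]
          · exact ⟨J, hJ, hJk⟩
        · rcases hK with rfl | hK
          · rwa [← hKk, hxr]
          · exact ⟨K, hK, hKk⟩
      · refine List.Perm.trans ?_ hperm.symm
        unfold addPoint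
        rw [if_neg hne, dif_pos hml]
        refine List.Perm.of_eq (congrArg (· :: Q₀) ?_)
        ext
        · exact hxl.symm
        · exact hmax.trans hxr.symm
      · have := minLeft_le_maxRight Q
        omega
      · rw [if_neg (by omega), hmax, Nat.add_zero]
    · push Not at hl
      have hi : minLeft Q < maxRight Q := by
        obtain ⟨J, hJ, hJr⟩ := hr
        have := hleft J hJ hJr
        have := hl J hJ
        have := J.left_le_right
        omega
      have hM : IsMoveThree Q₀ (minLeft Q) (maxRight Q - 1) x :=
        { left_eq := hxl
          right_eq := by omega
          pos := by
            obtain ⟨-, J, hJ, hJr⟩ := hmin 0 (Nat.zero_le _)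
            have := J.left_le_right
            rcases hJ with rfl | hJ
            · omega
            · have := hl J hJ
              omega
          le_old := by omega
          left_ne := hl
          right_le := fun J hJ => (hle J hJ).trans (by omega)
          lt_left := fun J hJ h =>
            lt_of_le_of_ne (hleft J hJ (by omega)) (hl J hJ).symm
          exists_right := by
            obtain ⟨J, hJ, hJr⟩ := hr
            exact ⟨J, hJ, by omega⟩
          minimal := fun k hk => by
            simpa only [List.mem_cons] using hmin k (by omega) }
      refine ⟨_, minLeft Q, hM.isMinimal_undo, ?_, ?_, ?_, rfl, ?_, fun hp hfx => ?_⟩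
      · rw [List.length_map, hlen₀]
      · rw [hM.addPoint_undo]
        exact hperm.symm
      · rw [hM.maxRight_undo]
        omega
      · rw [if_pos hM.minLeft_undo_lt, hM.maxRight_undo]
        omega
      · have hp' := hp.perm hperm
        have hfx' : ¬ ContainsFX₂ (x :: Q₀) := fun h => hfx (h.mono hperm.symm.subset)
        exact ⟨(hM.isProper_undo_or hp').resolve_right hfx',
          fun h => hfx' (hM.containsFX₂_of_undo hp' h)⟩
  · push Not at hr
    have hlt : ∀ J ∈ Q₀, J.right < maxRight Q := fun J hJ => lt_of_le_of_ne (hle J hJ) (hr J hJ)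
    -- Some interval must start at `maxRight Q`, and only `x` reaches that far, so `x` is a single
    -- point.
    have hi : minLeft Q = maxRight Q := by
      obtain ⟨⟨J, hJ, hJl⟩, -⟩ := hmin _ le_rfl
      rcases hJ with rfl | hJ
      · omega
      · have := hlt J hJ
        have := J.left_le_right
        omega
    have hpos : 0 < maxRight Q := by
      obtain ⟨J, hJ⟩ := List.exists_mem_of_ne_nil _ hne
      have := hlt J hJ
      omega
    have hmin₀ : ∀ k < maxRight Q, (∃ J ∈ Q₀, J.left = k) ∧ ∃ J ∈ Q₀, J.right = k := by
      intro k hk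
      obtain ⟨⟨J, hJ, hJk⟩, ⟨K, hK, hKk⟩⟩ := hmin k hk.le
      constructor
      · rcases hJ with rfl | hJ
        · omega
        · exact ⟨J, hJ, hJk⟩
      · rcases hK with rfl | hK
        · omega
        · exact ⟨K, hK, hKk⟩
    have hmax : maxRight Q₀ = maxRight Q - 1 :=
      maxRight_eq (fun J hJ => by have := hlt J hJ; omega) (hmin₀ _ (by omega)).2
    have hml := minLeft_le_maxRight Q₀
    refine ⟨Q₀, minLeft Q, ⟨hne, fun k hk => hmin₀ k (by omega)⟩, hlen₀.symm, ?_, by omega, rfl,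
      ?_, hsub⟩
    · refine List.Perm.trans ?_ hperm.symm
      unfold addPoint
      rw [if_neg hne, dif_neg (by omega), dif_neg (by omega)]
      refine List.Perm.of_eq (congrArg (· :: Q₀) ?_)
      ext
      · change maxRight Q₀ + 1 = x.left
        omega
      · change maxRight Q₀ + 1 = x.right
        omega
    · rw [if_pos (by omega)]
      omega

/-! ### Ascent sequences -/

theorem asc_append_singleton {x : List ℕ} (hx : x ≠ []) (i : ℕ) :
    asc (x ++ [i]) = asc x + if x.getD (x.length - 1) 0 < i then 1 else 0 := by
  have hpos := List.length_pos_of_ne_nil hx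
  have e1 : ∀ k, k < x.length → (x ++ [i]).getD k 0 = x.getD k 0 := fun k hk =>
    List.getD_append _ _ _ _ hk
  have e2 : (x ++ [i]).getD x.length 0 = i := by simp
  obtain ⟨n, hn⟩ : ∃ n, x.length = n + 1 := ⟨x.length - 1, by omega⟩
  have e3 : (x ++ [i]).length - 1 = n + 1 := by simp [hn]
  unfold asc
  rw [e3, hn, Finset.range_add_one, Finset.filter_insert]
  rw [hn] at e1 e2
  simp only [Nat.add_sub_cancel]
  have e4 : (Finset.range n).filter (fun j => (x ++ [i]).getD j 0 < (x ++ [i]).getD (j + 1) 0) =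
      (Finset.range n).filter fun j => x.getD j 0 < x.getD (j + 1) 0 := by
    refine Finset.filter_congr fun j hj => ?_
    rw [Finset.mem_range] at hj
    rw [e1 j (by omega), e1 (j + 1) (by omega)]
  rw [e1 n (by omega), e2, e4]
  split_ifs
  · rw [Finset.card_insert_of_notMem (by simp)]
  · rfl

theorem IsAscentSequence.append_singleton {x : List ℕ} (hx : IsAscentSequence x) {i : ℕ}
    (hi : i ≤ 1 + asc x) : IsAscentSequence (x ++ [i]) := by
  refine ⟨by rw [List.head?_append, hx.1]; rfl, fun k hk hk' => ?_⟩
  rw [List.length_append, List.length_singleton] at hk'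
  rcases Nat.lt_succ_iff_lt_or_eq.1 hk' with h | rfl
  · rw [List.getD_append _ _ _ _ h, List.take_append_of_le_length h.le]
    exact hx.2 k hk h
  · rw [List.take_left]
    simpa using hi

/-- A minimal, proper interval list without `FX₂` is the representation of an ascent sequence all
of whose nonempty initial subsequences correspond to semiorders. -/
theorem exists_hereditary_ascentSequence (n : ℕ) :
    ∀ Q : List NatInterval, Q.length = n + 1 → IsMinimal Q → IsProper Q → ¬ ContainsFX₂ Q →
      ∃ x : List ℕ, IsAscentSequence x ∧ x.length = n + 1 ∧ (representation x).Perm Q ∧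
        asc x = maxRight Q ∧ x.getD n 0 = minLeft Q ∧
        ∀ k : ℕ, 1 ≤ k → k ≤ x.length → IsSemiorder (PsiInv (x.take k)) := by
  induction n with
  | zero =>
    intro Q hlen hmin hprop hfx
    obtain ⟨J, rfl⟩ := List.length_eq_one_iff.1 hlen
    obtain ⟨⟨K, hK, hKl⟩, ⟨K', hK', hKr⟩⟩ := hmin.2 0 (Nat.zero_le _)
    rw [List.mem_singleton] at hK hK'
    subst hK hK'
    have hrep : representation [0] = [K'] :=
      congrArg (fun I => [I]) (NatInterval.ext hKl.symm hKr.symm)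
    refine ⟨[0], ⟨rfl, fun k hk hk' => ?_⟩, rfl, by rw [hrep], ?_, ?_, fun k hk hk' => ?_⟩
    · simp only [List.length_singleton] at hk'
      omega
    · rw [maxRight_eq (m := 0) (by simp [hKr]) (by simp [hKr])]
      rfl
    · have h1 := minLeft_le_maxRight [K']
      rw [maxRight_eq (m := 0) (by simp [hKr]) (by simp [hKr])] at h1
      simp only [List.getD_cons_zero]
      omega
    · rw [List.take_of_length_le hk]
      change IsSemiorder (IntervalOrder (representation [0]))
      rw [hrep]
      exact hprop.isSemiorder
  | succ n ih =>
    intro Q hlen hmin hprop hfx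
    obtain ⟨Q', i, hmin', hlen', hperm, hi, hml, hmr, hinh⟩ := hmin.exists_addPoint (by omega)
    obtain ⟨hprop', hfx'⟩ := hinh hprop hfx
    obtain ⟨x, hx, hxlen, hxperm, hasc, hlast, hsemi⟩ := ih Q' (by omega) hmin' hprop' hfx'
    have hne : x ≠ [] := by
      rintro rfl
      simp at hxlen
    have hperm' : (representation (x ++ [i])).Perm Q := by
      rw [representation, List.foldl_append]
      exact (addPoint_perm hxperm i).trans hperm
    refine ⟨x ++ [i], hx.append_singleton (by omega), by simp [hxlen], hperm', ?_, ?_,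
      fun k hk hk' => ?_⟩
    -- The previous term is `minLeft Q'`, so a new ascent occurs exactly when Move 2 or 3 raises the
    -- largest right endpoint. This keeps the number of ascents equal to `maxRight`.
    · rw [asc_append_singleton hne, hasc, hxlen, Nat.add_sub_cancel, hlast, hmr]
    · rw [hml, ← hxlen]
      simp
    · rcases hk'.eq_or_lt with rfl | h
      · rw [List.take_length]
        exact (hprop.perm hperm'.symm).isSemiorder
      · rw [List.length_append, List.length_singleton, Nat.lt_succ_iff] at h
        rw [List.take_append_of_le_length h]
        exact hsemi k hk h

theorem IsSemiorder.congr {P P' : Type*} [PartialOrder P] [PartialOrder P'] (e : P ≃o P')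
    (hP : IsSemiorder P) : IsSemiorder P' := by
  obtain ⟨l, r, len, ⟨hlr, hlt⟩, hlen⟩ := hP
  refine ⟨fun x => l (e.symm x), fun x => r (e.symm x), len, ⟨fun x => hlr _, fun x y => ?_⟩,
    fun x => hlen _⟩
  rw [← hlt, e.symm.lt_iff_lt]

end SemiorderDim

theorem theorem3p2 (P : Type*) [PartialOrder P] [Finite P] [Nonempty P]
    (hP : SemiorderDim.IsSemiorder P) (hnot : ¬ SemiorderDim.IsHereditary P) :
    Nonempty (SemiorderDim.FX₂ ↪o P) ∧ SemiorderDim.HasDimension P 3 := by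
  obtain ⟨Q, hQ, ⟨e⟩⟩ := hP.exists_isMinimal
  have hprop := hQ.isProper (hP.congr e)
  -- Without `FX₂` in `Q`, the reconstructed ascent sequence would witness that `P` is hereditary.
  have hfx : SemiorderDim.ContainsFX₂ Q := by
    by_contra hfx
    have hpos := List.length_pos_of_ne_nil hQ.1
    obtain ⟨x, hx, -, hperm, -, -, hsemi⟩ :=
      SemiorderDim.exists_hereditary_ascentSequence (Q.length - 1) Q (by omega) hQ hprop hfx
    obtain ⟨e'⟩ := SemiorderDim.IntervalOrder.orderIso_of_perm hperm
    exact hnot ⟨x, hx, ⟨e.trans e'.symm⟩, hsemi⟩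
  obtain ⟨g⟩ := hfx.exists_orderEmbedding
  have g' : SemiorderDim.FX₂ ↪o P := g.trans e.symm.toOrderEmbedding
  exact ⟨⟨g'⟩, hP.hasDimension_three g'⟩
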